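/- Let $\mathcal G$ be a connected, locally finite metric graph with countable vertex and edge sets (loops and parallel edges allowed), in which each edge $e$ has a length $l_e>0$ and is identified with the interval $[0,l_e]$. Equip $\mathcal G$ with the geodesic distance (the infimum of the lengths of paths), and let $\overline{\mathcal G}$ be its metric completion. Let $\partial\mathcal G$ be a set of vertices that contains all vertices of degree $1$; vertices outside $\partial\mathcal G$ are called interior vertices. Let $\mathcal G_{int}=\mathcal G\setminus\partial\mathcal G$ and $\partial\overline{\mathcal G}=\overline{\mathcal G}\setminus\mathcal G_{int}$. A continuous function $f:\overline{\mathcal G}\to\mathbb R$ is called harmonic if (i) $f''=0$ on each edge, that is, $f$ is affine in the coordinate of each edge, and (ii) at each interior vertex $v$ the Kirchhoff condition $\sum_{e\sim v}\partial_\nu f_e(v)=0$ holds, where $\partial_\nu f_e(v)$ is the derivative at $v$ of the restriction of $f$ to $e$, in the direction pointing from $v$ into $e$, and a loop at $v$ contributes one term for each of its two ends. Suppose that $\overline{\mathcal G}$ is compact and that $\partial\overline{\mathcal G}$ is nonempty and totally disconnected. Then for every continuous function $G:\partial\overline{\mathcal G}\to\mathbb R$ there is a unique harmonic function $g:\overline{\mathcal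 G}\to\mathbb R$ with $g=G$ on $\partial\overline{\mathcal G}$. -/

import Mathlib

/-- A connected, locally finite metric graph with vertex set `V`, edge set `E` and a chosen set of
boundary vertices.  Loops and parallel edges are allowed.  The edge `e` is identified with the
interval `[0, len e]`, where `0` is the vertex `endpt e false` and `len e` the vertex
`endpt e true`.  A pair `(e, i)` is an *end* of the edge `e`, so the ends at a vertex `v` count
each loop at `v` twice, and their number is the degree of `v`. -/
structure MetricGraph (V E : Type*) where
  /-- The two endpoints of an edge. -/
  endpt : E → Bool → V
  /-- The length of an edge. -/
  len : E → ℝ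
  len_pos : ∀ e, 0 < len e
  /-- Local finiteness. -/
  finite_ends : ∀ v, {d : E × Bool | endpt d.1 d.2 = v}.Finite
  /-- Any two vertices are joined by a vertex path. -/
  connected : ∀ u v,
    Relation.ReflTransGen (fun a b => ∃ e i, endpt e i = a ∧ endpt e (!i) = b) u v
  /-- The boundary vertices. -/
  bdry : Set V
  /-- Every vertex of degree one is a boundary vertex. -/
  mem_bdry_of_degree_one : ∀ v, {d : E × Bool | endpt d.1 d.2 = v}.ncard = 1 → v ∈ bdry

namespace MetricGraph

/-- The points of the metric graph: the vertices, and the interior points of the edges. -/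
inductive Point {V E : Type*} (G : MetricGraph V E) where
  | vertex (v : V) : Point G
  | inner (e : E) (t : ℝ) (h₀ : 0 < t) (h₁ : t < G.len e) : Point G

section Metric

variable {V E : Type*} (G : MetricGraph V E)

open Classical in
/-- The point of the edge `e` with coordinate `t ∈ [0, len e]` (extended constantly to `ℝ`). -/
noncomputable def edgePoint (e : E) (t : ℝ) : G.Point :=
  if h₀ : 0 < t then
    if h₁ : t < G.len e then .inner e t h₀ h₁ else .vertex (G.endpt e true)
  else .vertex (G.endpt e false)

/-- `G.IsPath x y L`: there is a path of length `L` from `x` to `y`, that is, a finite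
concatenation of segments, each of which lies on one closed edge. -/
inductive IsPath : G.Point → G.Point → ℝ → Prop
  | nil (x : G.Point) : IsPath x x 0
  | cons (e : E) (s t : ℝ) (y : G.Point) (L : ℝ) (hs : s ∈ Set.Icc 0 (G.len e))
      (ht : t ∈ Set.Icc 0 (G.len e)) (h : IsPath (G.edgePoint e t) y L) :
      IsPath (G.edgePoint e s) y (|s - t| + L)

theorem edgePoint_zero (e : E) : G.edgePoint e 0 = .vertex (G.endpt e false) := by
  simp [edgePoint]

theorem edgePoint_len (e : E) : G.edgePoint e (G.len e) = .vertex (G.endpt e true) := by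
  simp [edgePoint, G.len_pos e]

theorem edgePoint_inner (e : E) (t : ℝ) (h₀ : 0 < t) (h₁ : t < G.len e) :
    G.edgePoint e t = .inner e t h₀ h₁ := by
  simp [edgePoint, h₀, h₁]

variable {G}

theorem IsPath.nonneg {x y : G.Point} {L : ℝ} (h : G.IsPath x y L) : 0 ≤ L := by
  induction h with
  | nil x => exact le_rfl
  | cons e s t y L hs ht h ih => positivity

theorem IsPath.trans {x y z : G.Point} {L M : ℝ} (h : G.IsPath x y L) (k : G.IsPath y z M) :
    G.IsPath x z (L + M) := by
  induction h with
  | nil x => simpa using k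
  | cons e s t y L hs ht h ih =>
    rw [add_assoc]
    exact .cons e s t z _ hs ht (ih k)

theorem IsPath.segment (e : E) {s t : ℝ} (hs : s ∈ Set.Icc 0 (G.len e))
    (ht : t ∈ Set.Icc 0 (G.len e)) : G.IsPath (G.edgePoint e s) (G.edgePoint e t) |s - t| := by
  simpa using IsPath.cons e s t _ 0 hs ht (.nil _)

theorem IsPath.symm {x y : G.Point} {L : ℝ} (h : G.IsPath x y L) : G.IsPath y x L := by
  induction h with
  | nil x => exact .nil x
  | cons e s t y L hs ht h ih =>
    rw [add_comm, abs_sub_comm]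
    exact ih.trans (.segment e ht hs)

theorem exists_isPath_endpt (e : E) (i : Bool) :
    ∃ L, G.IsPath (.vertex (G.endpt e i)) (.vertex (G.endpt e (!i))) L := by
  have h0 : (0 : ℝ) ∈ Set.Icc 0 (G.len e) := ⟨le_rfl, (G.len_pos e).le⟩
  have h1 : G.len e ∈ Set.Icc 0 (G.len e) := ⟨(G.len_pos e).le, le_rfl⟩
  have h := IsPath.segment e h0 h1
  rw [edgePoint_zero, edgePoint_len] at h
  cases i
  · exact ⟨_, h⟩
  · exact ⟨_, h.symm⟩

theorem exists_isPath_vertex (x : G.Point) : ∃ v L, G.IsPath x (.vertex v) L := by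
  cases x with
  | vertex v => exact ⟨v, 0, .nil _⟩
  | inner e t h₀ h₁ =>
    have h := IsPath.segment (G := G) e (s := t) (t := 0) ⟨h₀.le, h₁.le⟩ ⟨le_rfl, (G.len_pos e).le⟩
    rw [edgePoint_zero, edgePoint_inner G e t h₀ h₁] at h
    exact ⟨_, _, h⟩

theorem exists_isPath (x y : G.Point) : ∃ L, G.IsPath x y L := by
  obtain ⟨u, L, hu⟩ := exists_isPath_vertex x
  obtain ⟨v, M, hv⟩ := exists_isPath_vertex y
  have key : ∃ N, G.IsPath (.vertex u) (.vertex v) N := by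
    have h := G.connected u v
    clear hv
    induction h with
    | refl => exact ⟨0, .nil _⟩
    | tail _ hab ih =>
      obtain ⟨N, hN⟩ := ih
      obtain ⟨e, i, rfl, rfl⟩ := hab
      obtain ⟨K, hK⟩ := exists_isPath_endpt (G := G) e i
      exact ⟨_, hN.trans hK⟩
  obtain ⟨N, hN⟩ := key
  exact ⟨_, (hu.trans hN).trans hv.symm⟩

/-- The geodesic distance: the infimum of the lengths of the paths from `x` to `y`. -/
noncomputable instance : Dist G.Point := ⟨fun x y => sInf {L | G.IsPath x y L}⟩

theorem dist_def (x y : G.Point) : dist x y = sInf {L | G.IsPath x y L} := rfl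

theorem IsPath.dist_le {x y : G.Point} {L : ℝ} (h : G.IsPath x y L) : dist x y ≤ L :=
  csInf_le ⟨0, fun _ hL => hL.nonneg⟩ h

theorem le_dist {x y : G.Point} {c : ℝ} (h : ∀ L, G.IsPath x y L → c ≤ L) : c ≤ dist x y :=
  le_csInf (exists_isPath x y) h

/-- A function that is `1`-Lipschitz along each edge is `1`-Lipschitz. -/
theorem abs_sub_le_dist (φ : G.Point → ℝ)
    (hφ : ∀ e, ∀ s ∈ Set.Icc 0 (G.len e), ∀ t ∈ Set.Icc 0 (G.len e),
      |φ (G.edgePoint e s) - φ (G.edgePoint e t)| ≤ |s - t|) (x y : G.Point) :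
    |φ x - φ y| ≤ dist x y := by
  refine le_dist fun L h => ?_
  induction h with
  | nil x => simp
  | cons e s t y L hs ht h ih =>
    exact (abs_sub_le _ (φ (G.edgePoint e t)) _).trans (add_le_add (hφ e s hs t ht) ih)

noncomputable instance : PseudoMetricSpace G.Point where
  dist_self x := le_antisymm (IsPath.nil x).dist_le (le_dist fun _ h => h.nonneg)
  dist_comm x y :=
    le_antisymm (le_dist fun _ h => h.symm.dist_le) (le_dist fun _ h => h.symm.dist_le)
  dist_triangle x y z := by
    have h1 : dist x z - dist y z ≤ dist x y := le_dist fun L hL => by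
      have h2 : dist x z - L ≤ dist y z := le_dist fun M hM => by
        have := (hL.trans hM).dist_le
        linarith
      linarith
    linarith

theorem abs_tent_sub_le (r a s t : ℝ) : |max 0 (r - |s - a|) - max 0 (r - |t - a|)| ≤ |s - t| := by
  refine (abs_max_sub_max_le_max _ _ _ _).trans (max_le (by simp) ?_)
  have h := abs_abs_sub_abs_le_abs_sub (t - a) (s - a)
  have e1 : (r - |s - a|) - (r - |t - a|) = |t - a| - |s - a| := by ring
  have e2 : (t - a) - (s - a) = t - s := by ring
  rw [e1, abs_sub_comm s t, ← e2]
  exact h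

theorem eq_of_dist_inner (e₀ : E) (a : ℝ) (h₀ : 0 < a) (h₁ : a < G.len e₀) (y : G.Point)
    (h : dist (Point.inner e₀ a h₀ h₁) y = 0) : Point.inner e₀ a h₀ h₁ = y := by
  classical
  set r := min a (G.len e₀ - a) with hr
  have hr0 : 0 < r := lt_min h₀ (by linarith)
  have hra : r ≤ a := min_le_left _ _
  have hrl : r ≤ G.len e₀ - a := min_le_right _ _
  let φ : G.Point → ℝ := fun x => match x with
    | .vertex _ => 0
    | .inner e t _ _ => if e = e₀ then max 0 (r - |t - a|) else 0
  have key : ∀ e, ∀ t ∈ Set.Icc 0 (G.len e),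
      φ (G.edgePoint e t) = if e = e₀ then max 0 (r - |t - a|) else 0 := by
    rintro e t ⟨ht0, ht1⟩
    rcases ht0.eq_or_lt with rfl | ht0
    · rw [edgePoint_zero]
      split_ifs with he
      · subst he
        have : |0 - a| = a := by rw [zero_sub, abs_neg, abs_of_pos h₀]
        rw [this, max_eq_left (by linarith)]
      · rfl
    rcases ht1.eq_or_lt with rfl | ht1
    · rw [edgePoint_len]
      split_ifs with he
      · subst he
        rw [abs_of_pos (by linarith), max_eq_left (by linarith)]
      · rfl
    · rw [edgePoint_inner G e t ht0 ht1]
  have hL := abs_sub_le_dist φ (fun e s hs t ht => by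
    rw [key e s hs, key e t ht]
    split_ifs
    · exact abs_tent_sub_le r a s t
    · simp) (Point.inner e₀ a h₀ h₁) y
  rw [h] at hL
  have h2 : φ (Point.inner e₀ a h₀ h₁) = φ y := by
    have := abs_nonpos_iff.mp hL
    linarith
  have h3 : φ (Point.inner e₀ a h₀ h₁) = r := by simp [φ, hr0.le]
  cases y with
  | vertex v =>
    have h4 : φ (Point.vertex v) = 0 := rfl
    linarith
  | inner e t k₀ k₁ =>
    have h4 : φ (Point.inner e t k₀ k₁) = if e = e₀ then max 0 (r - |t - a|) else 0 := rfl
    rw [h3, h4] at h2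
    split_ifs at h2 with he
    · subst he
      have h5 : |t - a| = 0 := by
        rcases max_cases 0 (r - |t - a|) with ⟨h6, _⟩ | ⟨h6, _⟩ <;> linarith
      have : t = a := by
        have := abs_eq_zero.mp h5
        linarith
      subst this
      rfl
    · linarith

theorem eq_of_dist_vertex (v w : V)
    (h : dist (Point.vertex v : G.Point) (Point.vertex w) = 0) : v = w := by
  classical
  obtain ⟨r, hr0, hr⟩ : ∃ r : ℝ, 0 < r ∧ ∀ e i, G.endpt e i = v → r ≤ G.len e := by
    rcases (G.finite_ends v).toFinset.eq_empty_or_nonempty with h0 | h0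
    · refine ⟨1, one_pos, fun e i hi => ?_⟩
      have : (e, i) ∈ (G.finite_ends v).toFinset := by simpa using hi
      simp [h0] at this
    · obtain ⟨d, _, hd⟩ := Finset.exists_min_image _ (fun d : E × Bool => G.len d.1) h0
      exact ⟨_, G.len_pos d.1, fun e i hi => hd (e, i) (by simpa using hi)⟩
  let ψ : E → ℝ → ℝ := fun e t =>
    max (if G.endpt e false = v then max 0 (r - |t - 0|) else 0)
      (if G.endpt e true = v then max 0 (r - |t - G.len e|) else 0)
  let φ : G.Point → ℝ := fun x => match x with
    | .vertex u => if u = v then r else 0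
    | .inner e t _ _ => ψ e t
  have key : ∀ e, ∀ t ∈ Set.Icc 0 (G.len e), φ (G.edgePoint e t) = ψ e t := by
    rintro e t ⟨ht0, ht1⟩
    have hl := G.len_pos e
    rcases ht0.eq_or_lt with rfl | ht0
    · rw [edgePoint_zero]
      have h1 : G.endpt e true = v → max 0 (r - |0 - G.len e|) = 0 := fun hv => by
        rw [zero_sub, abs_neg, abs_of_pos hl, max_eq_left (by linarith [hr e true hv])]
      simp only [φ, ψ]
      split_ifs with ha hb hb <;> simp_all [hr0.le]
    rcases ht1.eq_or_lt with rfl | ht1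
    · rw [edgePoint_len]
      have h1 : G.endpt e false = v → max 0 (r - |G.len e - 0|) = 0 := fun hv => by
        rw [sub_zero, abs_of_pos hl, max_eq_left (by linarith [hr e false hv])]
      simp only [φ, ψ]
      split_ifs with ha hb hb <;> simp_all [hr0.le]
    · rw [edgePoint_inner G e t ht0 ht1]
  have hL := abs_sub_le_dist φ (fun e s hs t ht => by
    rw [key e s hs, key e t ht]
    refine (abs_max_sub_max_le_max _ _ _ _).trans (max_le ?_ ?_)
    · split_ifs
      · exact abs_tent_sub_le r _ s t
      · simp
    · split_ifs
      · exact abs_tent_sub_le r _ s t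
      · simp) (Point.vertex v) (Point.vertex w)
  rw [h] at hL
  have h2 : φ (Point.vertex v) = φ (Point.vertex w) := by
    have := abs_nonpos_iff.mp hL
    linarith
  by_contra hvw
  have h3 : φ (Point.vertex v) = r := by simp [φ]
  have h4 : φ (Point.vertex w) = 0 := by simp [φ, Ne.symm hvw]
  linarith

/-- The geodesic distance makes the metric graph a metric space. -/
noncomputable instance : MetricSpace G.Point where
  eq_of_dist_eq_zero {x y} h := by
    cases x with
    | inner e t h₀ h₁ => exact eq_of_dist_inner e t h₀ h₁ y h
    | vertex v =>
      cases y with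
      | inner e t h₀ h₁ => exact (eq_of_dist_inner e t h₀ h₁ _ (by rw [dist_comm]; exact h)).symm
      | vertex w => rw [eq_of_dist_vertex v w h]

end Metric

section Harmonic

variable {V E : Type*} (G : MetricGraph V E)

/-- The metric completion of the metric graph. -/
abbrev Completion : Type _ := UniformSpace.Completion G.Point

/-- The interior of the graph: all its points except the boundary vertices. -/
def interior : Set G.Point := (Point.vertex '' G.bdry)ᶜ

/-- The boundary of the completion: the complement of the interior of the graph. -/
def boundary : Set G.Completion := ((fun x : G.Point => (x : G.Completion)) '' G.interior)ᶜ

/-- The component of `f` on the edge `e`, as a function of the coordinate in `[0, len e]`. -/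
noncomputable def component (f : G.Completion → ℝ) (e : E) (t : ℝ) : ℝ :=
  f (G.edgePoint e t : G.Completion)

/-- The derivative at the end `d = (e, i)` of the edge `e` of the component of `f`, in the
direction pointing from the vertex `endpt e i` into the edge. -/
noncomputable def outwardDeriv (f : G.Completion → ℝ) (d : E × Bool) : ℝ :=
  match d.2 with
  | false => derivWithin (G.component f d.1) (Set.Icc 0 (G.len d.1)) 0
  | true => -derivWithin (G.component f d.1) (Set.Icc 0 (G.len d.1)) (G.len d.1)

/-- A continuous function on the completion is harmonic if its second derivative vanishes on each
edge and the Kirchhoff condition holds at each interior vertex. -/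
structure IsHarmonic (f : G.Completion → ℝ) : Prop where
  continuous : Continuous f
  contDiffOn : ∀ e, ContDiffOn ℝ 2 (G.component f e) (Set.Icc 0 (G.len e))
  deriv_two : ∀ e, ∀ t ∈ Set.Icc 0 (G.len e),
    iteratedDerivWithin 2 (G.component f e) (Set.Icc 0 (G.len e)) t = 0
  kirchhoff : ∀ v, v ∉ G.bdry → ∑ d ∈ (G.finite_ends v).toFinset, G.outwardDeriv f d = 0

end Harmonic

end MetricGraph

/-! Uniqueness is the maximum principle. A maximum exceeding the boundary values is attained at an
interior vertex; the Kirchhoff condition forces the same value at all neighbours, hence by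
connectedness at all vertices and by density everywhere, contradicting the value at a boundary
point.

Existence combines an energy argument with an approximation of the boundary data. For a continuous
edgewise affine function, Cauchy–Schwarz along a chain of edges bounds the oscillation by the square
root of diameter times energy (`sub_le_mul_norm_gradL2`). On functions vanishing on the boundary,
the energy norm therefore controls the supremum norm. Given `f` of finite energy, project its
gradient orthogonally onto the closure of the gradients of such functions. By this control the
projection is the gradient of a continuous `ψ` vanishing on the boundary. The gradient of `f - ψ` is
orthogonal to the gradients of hat functions at interior vertices, which is exactly the Kirchhoff
condition (`inner_gradL2_hat`). So boundary values of finite energy functions are attained.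

The indicator of a clopen subset of the boundary is such a boundary value: it extends continuously
to a function that varies only along finitely many edges, because a compact set away from the
boundary meets only finitely many edges (`exists_isHarmonic_indicator`). Linear combinations give
all locally constant functions, which are dense by Stone–Weierstrass as the boundary is compact and
totally disconnected. By the maximum principle, restriction to the boundary is an isometry on the
complete space of harmonic functions, so its range is closed and hence everything. -/

open Set Filter Topology

namespace MetricGraph

variable {V E : Type*} {G : MetricGraph V E}

/-! ### Functions on the points of a metric graph -/

/-- The function on the graph with values `h` at the vertices and `ψ e` inside the edge `e`. -/
def glue (h : V → ℝ) (ψ : E → ℝ → ℝ) : G.Point → ℝ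
  | .vertex v => h v
  | .inner e t _ _ => ψ e t

theorem glue_edgePoint {h : V → ℝ} {ψ : E → ℝ → ℝ} {e : E} (h0 : ψ e 0 = h (G.endpt e false))
    (h1 : ψ e (G.len e) = h (G.endpt e true)) {t : ℝ} (ht : t ∈ Icc 0 (G.len e)) :
    glue h ψ (G.edgePoint e t) = ψ e t := by
  rcases ht.1.eq_or_lt with rfl | ht0
  · rw [edgePoint_zero, h0, glue]
  rcases ht.2.eq_or_lt with rfl | ht1
  · rw [edgePoint_len, h1, glue]
  · rw [edgePoint_inner G e t ht0 ht1, glue]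

variable (G) in
/-- The interpolation of a vertex function that is affine on each edge. -/
noncomputable def interp (h : V → ℝ) : G.Point → ℝ :=
  glue h fun e t =>
    h (G.endpt e false) + t / G.len e * (h (G.endpt e true) - h (G.endpt e false))

@[simp] theorem interp_vertex (h : V → ℝ) (v : V) : G.interp h (.vertex v) = h v := rfl

theorem interp_edgePoint (h : V → ℝ) {e : E} {t : ℝ} (ht : t ∈ Icc 0 (G.len e)) :
    G.interp h (G.edgePoint e t) =
      h (G.endpt e false) + t / G.len e * (h (G.endpt e true) - h (G.endpt e false)) := by
  have hl := (G.len_pos e).ne'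
  exact glue_edgePoint (by simp) (by simp [hl]) ht

/-- After division by `K` the slopes on the edges are at most one, so `abs_sub_le_dist` applies.
Such functions serve both as test functions bounding distances from below and as functions that
extend to the completion. -/
theorem abs_interp_sub_le {h : V → ℝ} {K : ℝ} (hK : 0 < K)
    (hh : ∀ e, |h (G.endpt e true) - h (G.endpt e false)| ≤ K * G.len e) (x y : G.Point) :
    |G.interp h x - G.interp h y| ≤ K * dist x y := by
  have key := abs_sub_le_dist (fun p => K⁻¹ * G.interp h p) (fun e s hs t ht => by
    have hl := G.len_pos e
    rw [interp_edgePoint h hs, interp_edgePoint h ht]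
    have : K⁻¹ * (h (G.endpt e false) + s / G.len e * (h (G.endpt e true) - h (G.endpt e false))) -
        K⁻¹ * (h (G.endpt e false) + t / G.len e * (h (G.endpt e true) - h (G.endpt e false))) =
        (s - t) * ((h (G.endpt e true) - h (G.endpt e false)) / (K * G.len e)) := by
      field_simp
      ring
    rw [this, abs_mul, abs_div, abs_of_pos (mul_pos hK hl)]
    exact mul_le_of_le_one_right (abs_nonneg _) ((div_le_one (mul_pos hK hl)).2 (hh e))) x y
  rw [← mul_sub, abs_mul, abs_of_pos (inv_pos.2 hK)] at key
  rwa [inv_mul_le_iff₀ hK] at key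

theorem abs_sub_le_dist_vertex {h : V → ℝ}
    (hh : ∀ e, |h (G.endpt e true) - h (G.endpt e false)| ≤ G.len e) (v w : V) :
    |h v - h w| ≤ dist (Point.vertex v : G.Point) (Point.vertex w) := by
  simpa using abs_interp_sub_le (G := G) one_pos (by simpa using hh) (.vertex v) (.vertex w)

/-! ### Edges and neighbourhoods -/

theorem continuousOn_edgePoint (e : E) : ContinuousOn (G.edgePoint e) (Icc 0 (G.len e)) := by
  refine LipschitzOnWith.continuousOn (K := 1) (LipschitzOnWith.of_dist_le_mul fun s hs t ht => ?_)
  simpa [Real.dist_eq] using (IsPath.segment e hs ht).dist_le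

variable (G) in
/-- The closed edge `e`, as a set of points of the graph. -/
def closedEdge (e : E) : Set G.Point := G.edgePoint e '' Icc 0 (G.len e)

theorem isCompact_closedEdge (e : E) : IsCompact (G.closedEdge e) :=
  isCompact_Icc.image_of_continuousOn (continuousOn_edgePoint e)

theorem isPreconnected_closedEdge (e : E) : IsPreconnected (G.closedEdge e) :=
  isPreconnected_Icc.image _ (continuousOn_edgePoint e)

theorem inner_mem_closedEdge (e : E) (t : ℝ) (h₀ : 0 < t) (h₁ : t < G.len e) :
    Point.inner e t h₀ h₁ ∈ G.closedEdge e :=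
  ⟨t, ⟨h₀.le, h₁.le⟩, edgePoint_inner G e t h₀ h₁⟩

theorem endpt_mem_closedEdge (e : E) (i : Bool) : .vertex (G.endpt e i) ∈ G.closedEdge e := by
  have hl := (G.len_pos e).le
  cases i
  · exact ⟨0, ⟨le_rfl, hl⟩, edgePoint_zero G e⟩
  · exact ⟨_, ⟨hl, le_rfl⟩, edgePoint_len G e⟩

theorem vertex_mem_closedEdge {e : E} {v : V} (h : .vertex v ∈ G.closedEdge e) :
    ∃ i, G.endpt e i = v := by
  obtain ⟨t, ht, h⟩ := h
  rcases ht.1.eq_or_lt with rfl | ht0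
  · exact ⟨false, by simpa [edgePoint_zero] using h⟩
  rcases ht.2.eq_or_lt with rfl | ht1
  · exact ⟨true, by simpa [edgePoint_len] using h⟩
  · simp [edgePoint_inner G e t ht0 ht1] at h

theorem inner_mem_closedEdge_iff {e e' : E} {t : ℝ} {h₀ : 0 < t} {h₁ : t < G.len e} :
    Point.inner e t h₀ h₁ ∈ G.closedEdge e' ↔ e' = e := by
  refine ⟨fun ⟨s, hs, h⟩ => ?_, ?_⟩
  · rcases hs.1.eq_or_lt with rfl | hs0
    · simp [edgePoint_zero] at h
    rcases hs.2.eq_or_lt with rfl | hs1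
    · simp [edgePoint_len] at h
    · simp only [edgePoint_inner G e' s hs0 hs1, Point.inner.injEq] at h
      exact h.1
  · rintro rfl
    exact inner_mem_closedEdge _ _ _ _

theorem finite_edges_at (v : V) : {e | ∃ i, G.endpt e i = v}.Finite :=
  ((G.finite_ends v).image Prod.fst).subset fun e ⟨i, hi⟩ => ⟨(e, i), hi, rfl⟩

theorem exists_pos_le_len (v : V) : ∃ r : ℝ, 0 < r ∧ ∀ e i, G.endpt e i = v → r ≤ G.len e := by
  rcases (finite_edges_at (G := G) v).toFinset.eq_empty_or_nonempty with h0 | h0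
  · refine ⟨1, one_pos, fun e i hi => ?_⟩
    have := (finite_edges_at (G := G) v).mem_toFinset.2 ⟨i, hi⟩
    rw [h0] at this
    simp at this
  · obtain ⟨d, _, hd⟩ := Finset.exists_min_image _ G.len h0
    exact ⟨_, G.len_pos d, fun e i hi => hd e ((finite_edges_at v).mem_toFinset.2 ⟨i, hi⟩)⟩

/-- A small ball around a point contains no vertex apart from its centre, and it meets only the
edges that contain its centre, which are finitely many. -/
theorem exists_ball (p : G.Point) : ∃ r > 0, ∃ B : Set E, B.Finite ∧
    (∀ q, dist p q < r → (∀ v, q = .vertex v → q = p) ∧ ∀ e, q ∈ G.closedEdge e → e ∈ B) := by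
  classical
  cases p with
  | vertex v =>
    obtain ⟨r, hr, hrl⟩ := exists_pos_le_len (G := G) v
    -- The interpolation of `h` is `1`-Lipschitz, since `r` is at most the length of every edge at
    -- `v`. It equals `r` at `v`, so it is positive on the ball of radius `r`; but it vanishes at
    -- all other vertices and on all edges not at `v`.
    set h : V → ℝ := fun u => if u = v then r else 0 with hh
    have hLip := abs_interp_sub_le (G := G) (h := h) one_pos (fun e => by
      have hl := G.len_pos e
      have h1 := hrl e true
      have h0 := hrl e false
      simp only [hh]
      split_ifs with ha hb hb <;> simp_all [abs_of_pos hr, hl.le]) (.vertex v)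
    refine ⟨r, hr, _, finite_edges_at (G := G) v, fun q hq => ?_⟩
    have hpos : 0 < G.interp h q := by
      have h1 := (abs_le.1 (hLip q)).2
      have h2 : G.interp h (.vertex v) = r := by simp [hh]
      linarith
    cases q with
    | vertex u =>
      have huv : u = v := by
        by_contra hne
        simp [hh, hne] at hpos
      subst huv
      exact ⟨fun _ _ => rfl, fun e he => vertex_mem_closedEdge he⟩
    | inner e t h₀ h₁ =>
      refine ⟨fun _ h => by simp at h, fun e' he' => ?_⟩
      obtain rfl := inner_mem_closedEdge_iff.1 he'
      by_contra hne
      have h0 : G.endpt e' false ≠ v := fun h => hne ⟨_, h⟩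
      have h1 : G.endpt e' true ≠ v := fun h => hne ⟨_, h⟩
      rw [← edgePoint_inner G e' t h₀ h₁, interp_edgePoint h ⟨h₀.le, h₁.le⟩] at hpos
      simp [hh, h0, h1] at hpos
  | inner e₀ a h₀ h₁ =>
    set r := min a (G.len e₀ - a) with hr
    have hr0 : 0 < r := lt_min h₀ (by linarith)
    have hra : r ≤ a := min_le_left _ _
    have hrl : r ≤ G.len e₀ - a := min_le_right _ _
    -- The same argument with a tent supported in the single edge `e₀`, zero at its ends by the
    -- choice of `r`.
    set ψ : E → ℝ → ℝ := fun e t => if e = e₀ then max 0 (r - |t - a|) else 0 with hψ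
    have hLip := abs_sub_le_dist (G := G) (glue 0 ψ) (fun e s hs t ht => by
      have e0 : ψ e 0 = 0 := by
        simp only [hψ]
        split_ifs
        · rw [zero_sub, abs_neg, abs_of_pos h₀, max_eq_left (by linarith)]
        · rfl
      have e1 : ψ e (G.len e) = 0 := by
        simp only [hψ]
        split_ifs with he
        · subst he
          rw [abs_of_pos (by linarith), max_eq_left (by linarith)]
        · rfl
      rw [glue_edgePoint e0 e1 hs, glue_edgePoint e0 e1 ht]
      simp only [hψ]
      split_ifs
      · exact abs_tent_sub_le r a s t
      · simp) (.inner e₀ a h₀ h₁)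
    refine ⟨r, hr0, {e₀}, finite_singleton _, fun q hq => ?_⟩
    have hpos : 0 < glue 0 ψ q := by
      have h1 := (abs_le.1 (hLip q)).2
      have h2 : glue 0 ψ (Point.inner e₀ a h₀ h₁ : G.Point) = r := by simp [glue, hψ, hr0.le]
      linarith
    cases q with
    | vertex u => simp [glue] at hpos
    | inner e t k₀ k₁ =>
      refine ⟨fun _ h => by simp at h, fun e' he' => ?_⟩
      obtain rfl := inner_mem_closedEdge_iff.1 he'
      by_contra hne
      simp only [mem_singleton_iff] at hne
      simp [glue, hψ, hne] at hpos

/-! ### The completion -/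

theorem mem_boundary_iff {x : G.Completion} :
    x ∈ G.boundary ↔ ∀ p : G.Point, (p : G.Completion) = x → ∃ v ∈ G.bdry, p = .vertex v := by
  simp only [boundary, interior, mem_compl_iff, mem_image, not_exists, not_and]
  refine forall_congr' fun p => ⟨fun h hp => ?_, fun h hn hp => ?_⟩
  · by_contra hne
    exact h (fun v hv hvp => hne ⟨v, hv, hvp.symm⟩) hp
  · obtain ⟨v, hv, rfl⟩ := h hp
    exact hn v hv rfl

theorem vertex_mem_boundary {v : V} (hv : v ∈ G.bdry) :
    ((Point.vertex v : G.Point) : G.Completion) ∈ G.boundary :=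
  mem_boundary_iff.2 fun _ hp => ⟨v, hv, UniformSpace.Completion.coe_injective _ hp⟩

/-- Two continuous functions that agree on the graph off a compact set `K` agree on the completion
off `K`. -/
theorem eq_of_eq_off_compact {f g : G.Completion → ℝ} (hf : Continuous f) (hg : Continuous g)
    {K : Set G.Point} (hK : IsCompact K) (h : ∀ p ∉ K, f p = g p) {x : G.Completion}
    (hx : x ∉ (fun p : G.Point => (p : G.Completion)) '' K) : f x = g x := by
  have hKc := (hK.image (UniformSpace.Completion.continuous_coe G.Point)).isClosed
  have h1 := UniformSpace.Completion.denseRange_coe.open_subset_closure_inter hKc.isOpen_compl hx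
  refine closure_minimal ?_ (isClosed_eq hf hg) h1
  rintro _ ⟨hy, p, rfl⟩
  exact h p fun hp => hy ⟨p, hp, rfl⟩

/-- By local finiteness, the graph points of a small ball around an interior point `p` lie in a
finite union of closed edges and `{p}`. This set is compact, hence closed in the completion, so the
ball acquires no new points there; nor does it contain a vertex other than `p`. The singleton is
needed in case `p` is an isolated vertex. -/
theorem isClosed_boundary : IsClosed G.boundary := by
  refine isOpen_compl_iff.1 (Metric.isOpen_iff.2 fun x hx => ?_)
  rw [boundary, compl_compl] at hx
  obtain ⟨p, hp, rfl⟩ := hx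
  obtain ⟨r, hr, B, hB, hball⟩ := exists_ball p
  refine ⟨r, hr, fun y hy => ?_⟩
  have hKc : IsCompact ({p} ∪ ⋃ e ∈ B, G.closedEdge e) :=
    isCompact_singleton.union (hB.isCompact_biUnion fun e _ => isCompact_closedEdge e)
  have hKc' := (hKc.image (UniformSpace.Completion.continuous_coe G.Point)).isClosed
  have h1 := UniformSpace.Completion.denseRange_coe.open_subset_closure_inter
    Metric.isOpen_ball hy
  have h2 : Metric.ball (p : G.Completion) r ∩ range (fun p : G.Point => (p : G.Completion)) ⊆
      (fun p : G.Point => (p : G.Completion)) '' ({p} ∪ ⋃ e ∈ B, G.closedEdge e) := by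
    rintro _ ⟨hq, q, rfl⟩
    refine ⟨q, ?_, rfl⟩
    rw [Metric.mem_ball, UniformSpace.Completion.dist_eq, dist_comm] at hq
    obtain ⟨h3, h4⟩ := hball q hq
    cases q with
    | vertex v => exact Or.inl (h3 v rfl)
    | inner e t h₀ h₁ =>
      have := inner_mem_closedEdge e t h₀ h₁
      exact Or.inr (mem_biUnion (h4 e this) this)
  obtain ⟨q, -, rfl⟩ := closure_minimal h2 hKc' h1
  rw [boundary, compl_compl]
  refine ⟨q, ?_, rfl⟩
  rw [Metric.mem_ball, UniformSpace.Completion.dist_eq, dist_comm] at hy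
  rintro ⟨v, hv, rfl⟩
  exact hp ⟨v, hv, (hball _ hy).1 v rfl⟩

/-- A compact set that does not meet the boundary meets only finitely many edges. -/
theorem finite_edges_of_isCompact {K : Set G.Completion} (hK : IsCompact K)
    (hd : Disjoint K G.boundary) : {e | ∃ p ∈ G.closedEdge e, (p : G.Completion) ∈ K}.Finite := by
  choose r hr B hB hball using exists_ball (G := G)
  obtain ⟨s, hs⟩ := hK.elim_finite_subcover
    (fun p : G.Point => Metric.ball (p : G.Completion) (r p)) (fun _ => Metric.isOpen_ball)
    (fun x hx => by
      have hxb : x ∉ G.boundary := disjoint_left.1 hd hx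
      rw [boundary, mem_compl_iff, not_not] at hxb
      obtain ⟨p, -, rfl⟩ := hxb
      exact mem_iUnion.2 ⟨p, Metric.mem_ball_self (hr p)⟩)
  refine (s.finite_toSet.biUnion fun p _ => hB p).subset ?_
  rintro e ⟨q, hq, hqK⟩
  obtain ⟨p, hp, hqp⟩ := mem_iUnion₂.1 (hs hqK)
  rw [Metric.mem_ball, UniformSpace.Completion.dist_eq, dist_comm] at hqp
  exact mem_biUnion hp ((hball p q hqp).2 e hq)

variable (G) in
/-- The vertex `v` as a point of the completion. -/
noncomputable def vtx (v : V) : G.Completion := ((Point.vertex v : G.Point) : G.Completion)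

variable (G) in
/-- The functions on the completion that are affine on each edge. -/
def IsEdgeAffine (g : G.Completion → ℝ) : Prop :=
  ∀ e, ∀ t ∈ Icc 0 (G.len e), g (G.edgePoint e t) = g (G.vtx (G.endpt e false)) +
    t / G.len e * (g (G.vtx (G.endpt e true)) - g (G.vtx (G.endpt e false)))

/-- Values inside an edge are convex combinations of the values at its ends, and the graph is dense
in its completion. -/
theorem IsEdgeAffine.le {g : G.Completion → ℝ} (hg : G.IsEdgeAffine g) (hc : Continuous g) {c : ℝ}
    (h : ∀ v, g (G.vtx v) ≤ c) (x : G.Completion) : g x ≤ c := by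
  induction x using UniformSpace.Completion.induction_on with
  | hp => exact isClosed_le hc continuous_const
  | ih p =>
    cases p with
    | vertex v => exact h v
    | inner e t h₀ h₁ =>
      rw [← edgePoint_inner G e t h₀ h₁, hg e t ⟨h₀.le, h₁.le⟩]
      have a0 := h (G.endpt e false)
      have a1 := h (G.endpt e true)
      have t0 : 0 ≤ t / G.len e := by have := G.len_pos e; positivity
      have t1 : t / G.len e ≤ 1 := (div_le_one (G.len_pos e)).2 h₁.le
      nlinarith

theorem IsEdgeAffine.neg {g : G.Completion → ℝ} (hg : G.IsEdgeAffine g) : G.IsEdgeAffine (-g) := by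
  intro e t ht
  simp only [Pi.neg_apply, hg e t ht]
  ring

theorem IsEdgeAffine.add {f g : G.Completion → ℝ} (hf : G.IsEdgeAffine f)
    (hg : G.IsEdgeAffine g) : G.IsEdgeAffine (f + g) := by
  intro e t ht
  simp only [Pi.add_apply, hg e t ht, hf e t ht]
  ring

theorem IsEdgeAffine.smul (c : ℝ) {g : G.Completion → ℝ} (hg : G.IsEdgeAffine g) :
    G.IsEdgeAffine (c • g) := by
  intro e t ht
  simp only [Pi.smul_apply, hg e t ht, smul_eq_mul]
  ring

/-- A vertex function that is constant along all but finitely many edges extends to a continuous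
function on the completion that is affine on each edge. -/
theorem exists_isEdgeAffine (h : V → ℝ)
    (hfin : {e | h (G.endpt e true) ≠ h (G.endpt e false)}.Finite) :
    ∃ g : C(G.Completion, ℝ), G.IsEdgeAffine g ∧ ∀ p : G.Point, g p = G.interp h p := by
  obtain ⟨K, hK, hKe⟩ : ∃ K : ℝ, 0 < K ∧
      ∀ e, |h (G.endpt e true) - h (G.endpt e false)| ≤ K * G.len e := by
    obtain ⟨M, hM⟩ := (hfin.image
      fun e => |h (G.endpt e true) - h (G.endpt e false)| / G.len e).bddAbove
    -- `M` bounds the finitely many nonzero slopes; the `1` only makes the Lipschitz constant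
    -- positive.
    refine ⟨max M 1, by positivity, fun e => ?_⟩
    have hl := G.len_pos e
    by_cases he : h (G.endpt e true) = h (G.endpt e false)
    · rw [he, sub_self, abs_zero]
      positivity
    · rw [← div_le_iff₀ hl]
      exact (hM ⟨e, he, rfl⟩).trans (le_max_left _ _)
  have hu : UniformContinuous (G.interp h) := by
    refine LipschitzWith.uniformContinuous (K := ⟨K, hK.le⟩) (LipschitzWith.of_dist_le_mul ?_)
    intro x y
    rw [Real.dist_eq]
    exact abs_interp_sub_le hK hKe x y
  have hp : ∀ p : G.Point, UniformSpace.Completion.extension (G.interp h) p = G.interp h p :=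
    UniformSpace.Completion.extension_coe hu
  refine ⟨⟨UniformSpace.Completion.extension (G.interp h),
    UniformSpace.Completion.continuous_extension⟩, fun e t ht => ?_, hp⟩
  simp only [ContinuousMap.coe_mk, vtx, hp, interp_vertex]
  exact interp_edgePoint h ht

/-! ### Harmonic functions in terms of their vertex values -/

variable (G) in
/-- The difference quotient of `g` along the edge of an end, in the direction into the edge. -/
noncomputable def slope (g : G.Completion → ℝ) (d : E × Bool) : ℝ :=
  (g (G.vtx (G.endpt d.1 (!d.2))) - g (G.vtx (G.endpt d.1 d.2))) / G.len d.1

/-- The derivative of a function that is affine on an interval. -/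
theorem derivWithin_affine {φ : ℝ → ℝ} {l a b : ℝ} (hl : 0 < l)
    (h : ∀ t ∈ Icc 0 l, φ t = a + t / l * (b - a)) {t : ℝ} (ht : t ∈ Icc 0 l) :
    derivWithin φ (Icc 0 l) t = (b - a) / l := by
  rw [derivWithin_congr h (h t ht)]
  have hd : HasDerivAt (fun s : ℝ => a + s / l * (b - a)) (1 / l * (b - a)) t :=
    (((hasDerivAt_id t).div_const l).mul_const (b - a)).const_add a
  rw [hd.hasDerivWithinAt.derivWithin (uniqueDiffOn_Icc hl t ht)]
  ring

/-- A function on `[0, l]` with vanishing second derivative is affine. -/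
theorem affine_of_iteratedDerivWithin_two {φ : ℝ → ℝ} {l : ℝ} (hl : 0 < l)
    (hφ : ContDiffOn ℝ 2 φ (Icc 0 l)) (h2 : ∀ t ∈ Icc 0 l, iteratedDerivWithin 2 φ (Icc 0 l) t = 0) :
    ∀ t ∈ Icc 0 l, φ t = φ 0 + t / l * (φ l - φ 0) := by
  have hu := uniqueDiffOn_Icc hl
  have hd : DifferentiableOn ℝ φ (Icc 0 l) := hφ.differentiableOn (by norm_num)
  have hd1 : DifferentiableOn ℝ (derivWithin φ (Icc 0 l)) (Icc 0 l) :=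
    (hφ.derivWithin hu (m := 1) (by norm_num)).differentiableOn (by norm_num)
  have hconst := constant_of_derivWithin_zero hd1 fun t ht => by
    have := h2 t ⟨ht.1, ht.2.le⟩
    rwa [iteratedDerivWithin_succ, iteratedDerivWithin_one] at this
  set c := derivWithin φ (Icc 0 l) 0
  have h3 : ∀ t ∈ Icc 0 l, φ t - c * t = φ 0 - c * 0 := by
    refine constant_of_derivWithin_zero (f := fun t => φ t - c * t)
      (hd.sub (by fun_prop)) fun t ht => ?_
    have ht' : t ∈ Icc 0 l := ⟨ht.1, ht.2.le⟩
    have hd2 := (hd t ht').hasDerivWithinAt.sub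
      ((hasDerivAt_id t).const_mul c).hasDerivWithinAt
    refine (hd2.derivWithin (hu t ht')).trans ?_
    rw [hconst t ht']
    ring
  intro t ht
  have h4 := h3 t ht
  have h5 := h3 l ⟨hl.le, le_rfl⟩
  field_simp
  linear_combination l * h4 - t * h5

theorem component_zero (g : G.Completion → ℝ) (e : E) :
    G.component g e 0 = g (G.vtx (G.endpt e false)) := by
  rw [component, edgePoint_zero, vtx]

theorem component_len (g : G.Completion → ℝ) (e : E) :
    G.component g e (G.len e) = g (G.vtx (G.endpt e true)) := by
  rw [component, edgePoint_len, vtx]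

theorem outwardDeriv_eq {g : G.Completion → ℝ} (hg : G.IsEdgeAffine g) (d : E × Bool) :
    G.outwardDeriv g d = G.slope g d := by
  obtain ⟨e, i⟩ := d
  have hl := G.len_pos e
  have key := fun t => derivWithin_affine (t := t) hl (hg e)
  cases i
  · exact key 0 ⟨le_rfl, hl.le⟩
  · refine (congrArg Neg.neg (key _ ⟨hl.le, le_rfl⟩)).trans ?_
    simp only [slope, Bool.not_true]
    ring

/-- The derivatives of an edgewise affine function are difference quotients, so harmonicity becomes
a family of linear conditions on point values, stable under limits. -/
theorem isHarmonic_iff {g : G.Completion → ℝ} (hc : Continuous g) :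
    G.IsHarmonic g ↔ G.IsEdgeAffine g ∧
      ∀ v, v ∉ G.bdry → ∑ d ∈ (G.finite_ends v).toFinset, G.slope g d = 0 := by
  constructor
  · intro h
    have ha : G.IsEdgeAffine g := fun e t ht => by
      have := affine_of_iteratedDerivWithin_two (G.len_pos e) (h.contDiffOn e) (h.deriv_two e) t ht
      rwa [component_zero, component_len] at this
    refine ⟨ha, fun v hv => ?_⟩
    rw [← h.kirchhoff v hv]
    exact Finset.sum_congr rfl fun d _ => (outwardDeriv_eq ha d).symm
  · rintro ⟨ha, hk⟩
    refine ⟨hc, fun e => ?_, fun e t ht => ?_, fun v hv => ?_⟩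
    · exact ContDiffOn.congr (by fun_prop) (ha e)
    · have hl := G.len_pos e
      rw [iteratedDerivWithin_succ, iteratedDerivWithin_one]
      exact (derivWithin_congr (fun s hs => derivWithin_affine hl (ha e) hs)
        (derivWithin_affine hl (ha e) ht)).trans (by simp)
    · rw [← hk v hv]
      exact Finset.sum_congr rfl fun d _ => outwardDeriv_eq ha d

/-- The maximum principle. -/
theorem IsHarmonic.le_of_boundary [CompactSpace G.Completion] (hne : G.boundary.Nonempty)
    {g : G.Completion → ℝ} (hg : G.IsHarmonic g) {c : ℝ} (h : ∀ x ∈ G.boundary, g x ≤ c)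
    (x : G.Completion) : g x ≤ c := by
  have hc := hg.continuous
  obtain ⟨ha, hk⟩ := (isHarmonic_iff hc).1 hg
  obtain ⟨b, hb⟩ := hne
  obtain ⟨m, -, hm⟩ := isCompact_univ.exists_isMaxOn ⟨x, mem_univ x⟩ hc.continuousOn
  have hm' : ∀ y, g y ≤ g m := fun y => hm (mem_univ y)
  by_contra! hcx
  have hcm : c < g m := hcx.trans_le (hm' x)
  -- The maximum point is not in the boundary, so it is a point of the graph; an affine function
  -- with a maximum inside an edge is constant on that edge.
  obtain ⟨v₀, hv₀⟩ : ∃ v, g (G.vtx v) = g m := by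
    have hmb : m ∉ G.boundary := fun hmb => (h m hmb).not_gt hcm
    rw [boundary, mem_compl_iff, not_not] at hmb
    obtain ⟨p, -, hp⟩ := hmb
    cases p with
    | vertex v => exact ⟨v, congrArg g hp⟩
    | inner e t h₀ h₁ =>
      refine ⟨G.endpt e false, le_antisymm (hm' _) ?_⟩
      have hp' := ha e t ⟨h₀.le, h₁.le⟩
      rw [edgePoint_inner G e t h₀ h₁, show ((Point.inner e t h₀ h₁ : G.Point) : G.Completion) = m
        from hp] at hp'
      have t0 : 0 < t / G.len e := div_pos h₀ (G.len_pos e)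
      have t1 : t / G.len e < 1 := (div_lt_one (G.len_pos e)).2 h₁
      have a1 := hm' (G.vtx (G.endpt e true))
      nlinarith
  -- All outward slopes at a maximum are nonpositive and their sum is zero, so each is zero.
  have step : ∀ u, g (G.vtx u) = g m → ∀ e i, G.endpt e i = u →
      g (G.vtx (G.endpt e (!i))) = g m := by
    intro u hu e i hi
    have hub : u ∉ G.bdry := fun hub => (h _ (vertex_mem_boundary hub)).not_gt (by
      rw [vtx] at hu
      rwa [hu])
    have hmem : (e, i) ∈ (G.finite_ends u).toFinset := by simpa using hi
    have hnp : ∀ d ∈ (G.finite_ends u).toFinset, G.slope g d ≤ 0 := by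
      intro d hd
      have hd' : G.endpt d.1 d.2 = u := by simpa using hd
      rw [slope, hd', hu]
      exact div_nonpos_of_nonpos_of_nonneg (sub_nonpos.2 (hm' _)) (G.len_pos _).le
    have h0 := (Finset.sum_eq_zero_iff_of_nonpos hnp).1 (hk u hub) _ hmem
    rw [slope, div_eq_zero_iff] at h0
    simp only [hi, hu] at h0
    rcases h0 with h0 | h0
    · linarith
    · exact absurd h0 (G.len_pos e).ne'
  have hall : ∀ v, g (G.vtx v) = g m := by
    intro v
    induction G.connected v₀ v with
    | refl => exact hv₀
    | tail _ hab ih =>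
      obtain ⟨e, i, hi, rfl⟩ := hab
      exact step _ ih e i hi
  have hb' := ha.neg.le hc.neg (c := -g m) (fun v => by simp [hall v]) b
  have := h b hb
  simp only [Pi.neg_apply] at hb'
  linarith

/-! ### Chains of edges -/

variable (G) in
/-- `G.IsChain v w l`: the edges in the list `l`, in reverse order, lead from `v` to `w`. -/
inductive IsChain (v : V) : V → List E → Prop
  | nil : IsChain v v []
  | snoc (e : E) (i : Bool) (l : List E) (h : IsChain v (G.endpt e i) l) :
      IsChain v (G.endpt e (!i)) (e :: l)

theorem exists_isChain (v w : V) : ∃ l, G.IsChain v w l := by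
  induction G.connected v w with
  | refl => exact ⟨[], .nil⟩
  | tail _ hab ih =>
    obtain ⟨e, i, rfl, rfl⟩ := hab
    obtain ⟨l, hl⟩ := ih
    exact ⟨_, hl.snoc e i l⟩

theorem sum_len_nonneg (l : List E) : 0 ≤ (l.map G.len).sum :=
  List.sum_nonneg (by simpa using fun e _ => (G.len_pos e).le)

/-- Vertices at distance less than `D` are joined by a chain of edges of length less than `D`. -/
theorem exists_isChain_of_dist_lt {v w : V} {D : ℝ}
    (h : dist (Point.vertex v : G.Point) (Point.vertex w) < D) :
    ∃ l, G.IsChain v w l ∧ (l.map G.len).sum < D := by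
  -- The chain distance `sInf (A u)` from `v` changes along an edge by at most its length, so it is
  -- bounded by the geodesic distance.
  set A : V → Set ℝ := fun u => {L | ∃ l, G.IsChain v u l ∧ (l.map G.len).sum = L} with hA
  have hne : ∀ u, (A u).Nonempty := fun u => by
    obtain ⟨l, hl⟩ := exists_isChain (G := G) v u
    exact ⟨_, l, hl, rfl⟩
  have hbd : ∀ u, BddBelow (A u) := fun u => ⟨0, by
    rintro _ ⟨l, -, rfl⟩
    exact sum_len_nonneg l⟩
  have hstep : ∀ e i, sInf (A (G.endpt e (!i))) ≤ sInf (A (G.endpt e i)) + G.len e := by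
    intro e i
    rw [← sub_le_iff_le_add]
    refine le_csInf (hne _) ?_
    rintro _ ⟨l, hl, rfl⟩
    rw [sub_le_iff_le_add]
    refine csInf_le (hbd _) ⟨_, hl.snoc e i l, ?_⟩
    rw [List.map_cons, List.sum_cons, add_comm]
  have hdist := abs_sub_le_dist_vertex (h := fun u => sInf (A u)) (G := G) (fun e => by
    have h1 := hstep e true
    have h2 := hstep e false
    simp only [Bool.not_true, Bool.not_false] at h1 h2
    rw [abs_le]
    constructor <;> linarith) w v
  have hv : sInf (A v) ≤ 0 := csInf_le (hbd v) ⟨[], .nil, by simp⟩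
  rw [dist_comm] at hdist
  have hw : sInf (A w) < D := by linarith [le_abs_self (sInf (A w) - sInf (A v))]
  obtain ⟨_, ⟨l, hl, rfl⟩, hlt⟩ := exists_lt_of_csInf_lt (hne w) hw
  exact ⟨l, hl, hlt⟩

/-- A discrete intermediate value property. The union runs over the set of edges, so repetitions in
the chain do not matter; the point `h v` accounts for the empty chain. -/
theorem IsChain.uIcc_subset {v w : V} {l : List E} (hl : G.IsChain v w l) (h : V → ℝ) :
    uIcc (h v) (h w) ⊆ {h v} ∪ ⋃ e ∈ {e | e ∈ l},
      uIcc (h (G.endpt e false)) (h (G.endpt e true)) := by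
  induction hl with
  | nil => simp
  | snoc e i l hl ih =>
    intro x hx
    rcases uIcc_subset_uIcc_union_uIcc (b := h (G.endpt e i)) hx with hx | hx
    · refine (union_subset_union_right _ (biUnion_subset_biUnion_left ?_)) (ih hx)
      exact fun e' he' => List.mem_cons_of_mem _ he'
    · refine Or.inr (mem_biUnion (x := e) (by simp) ?_)
      cases i
      · exact hx
      · rw [uIcc_comm]
        exact hx

/-- The increment of a function along a chain is at most the sum of its increments over the set of
edges of the chain, without multiplicities. -/
theorem IsChain.abs_sub_le [DecidableEq E] {v w : V} {l : List E} (hl : G.IsChain v w l)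
    (h : V → ℝ) : |h w - h v| ≤ ∑ e ∈ l.toFinset, |h (G.endpt e true) - h (G.endpt e false)| := by
  -- Comparing Lebesgue measures in the covering by increments counts each edge once, with no need
  -- to make the chain simple.
  have h1 : MeasureTheory.volume (uIcc (h v) (h w)) ≤
      ∑ e ∈ l.toFinset, ENNReal.ofReal |h (G.endpt e true) - h (G.endpt e false)| := by
    refine (MeasureTheory.measure_mono (hl.uIcc_subset h)).trans
      ((MeasureTheory.measure_union_le _ _).trans ?_)
    rw [Real.volume_singleton, zero_add]
    have : {e | e ∈ l} = (l.toFinset : Set E) := by ext; simp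
    rw [this]
    refine (MeasureTheory.measure_biUnion_finset_le _ _).trans (le_of_eq ?_)
    exact Finset.sum_congr rfl fun e _ => Real.volume_interval
  rw [Real.volume_interval, ← ENNReal.ofReal_sum_of_nonneg (fun _ _ => abs_nonneg _)] at h1
  exact (ENNReal.ofReal_le_ofReal_iff (Finset.sum_nonneg fun _ _ => abs_nonneg _)).1 h1

theorem sum_toFinset_len_le [DecidableEq E] (l : List E) :
    ∑ e ∈ l.toFinset, G.len e ≤ (l.map G.len).sum := by
  induction l with
  | nil => simp
  | cons e l ih =>
    rw [List.toFinset_cons, List.map_cons, List.sum_cons]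
    by_cases he : e ∈ l.toFinset
    · rw [Finset.insert_eq_of_mem he]
      linarith [G.len_pos e]
    · rw [Finset.sum_insert he]
      linarith

/-! ### Functions of finite energy -/

variable (G) in
/-- The increment of `g` along the edge `e`, normalized so that its square is the Dirichlet energy
of `g` on `e`. -/
noncomputable def grad (g : G.Completion → ℝ) (e : E) : ℝ :=
  (g (G.vtx (G.endpt e true)) - g (G.vtx (G.endpt e false))) / √(G.len e)

theorem grad_add (f g : G.Completion → ℝ) : G.grad (f + g) = G.grad f + G.grad g := by
  ext e
  simp only [grad, Pi.add_apply]
  ring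

theorem grad_smul (c : ℝ) (g : G.Completion → ℝ) : G.grad (c • g) = c • G.grad g := by
  ext e
  simp only [grad, Pi.smul_apply, smul_eq_mul]
  ring

variable (G) in
/-- The continuous edgewise affine functions of finite Dirichlet energy. -/
noncomputable def finiteEnergy : Submodule ℝ C(G.Completion, ℝ) where
  carrier := {g | G.IsEdgeAffine g ∧ Memℓp (G.grad g) 2}
  zero_mem' := by
    refine ⟨fun e t _ => by simp, ?_⟩
    have : G.grad (0 : C(G.Completion, ℝ)) = 0 := by
      ext e
      simp [grad]
    rw [this]
    exact zero_memℓp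
  add_mem' {f g} hf hg := ⟨by simpa using hf.1.add hg.1, by
    rw [ContinuousMap.coe_add, grad_add]
    exact hf.2.add hg.2⟩
  smul_mem' c g hg := ⟨by simpa using hg.1.smul c, by
    rw [ContinuousMap.coe_smul, grad_smul]
    exact hg.2.const_smul c⟩

variable (G) in
/-- The gradient of a function of finite energy, as an element of a Hilbert space. -/
noncomputable def gradL2 : G.finiteEnergy →ₗ[ℝ] lp (fun _ : E => ℝ) 2 where
  toFun g := ⟨G.grad g.1, g.2.2⟩
  map_add' f g := Subtype.ext (by
    simp only [Submodule.coe_add, ContinuousMap.coe_add, grad_add]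
    rfl)
  map_smul' c g := Subtype.ext (by
    simp only [Submodule.coe_smul, ContinuousMap.coe_smul, grad_smul]
    rfl)

theorem gradL2_apply (g : G.finiteEnergy) (e : E) : G.gradL2 g e = G.grad g.1 e := rfl

theorem sum_sq_le_norm_sq (w : lp (fun _ : E => ℝ) 2) (s : Finset E) :
    ∑ e ∈ s, w e ^ 2 ≤ ‖w‖ ^ 2 := by
  simpa using lp.sum_rpow_le_norm_rpow (p := 2) (by norm_num) w s

/-- A function of finite energy oscillates at most by the square root of the product of its energy
with (a bound for) the diameter. -/
theorem sub_le_mul_norm_gradL2 {C : ℝ}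
    (hC : ∀ v w, dist (Point.vertex v : G.Point) (Point.vertex w) < C)
    (g : G.finiteEnergy) (x y : G.Completion) : g.1 x - g.1 y ≤ √C * ‖G.gradL2 g‖ := by
  classical
  have hvert : ∀ v w, g.1 (G.vtx w) - g.1 (G.vtx v) ≤ √C * ‖G.gradL2 g‖ := by
    intro v w
    obtain ⟨l, hl, hlC⟩ := exists_isChain_of_dist_lt (hC v w)
    have hC0 : 0 ≤ C := (sum_len_nonneg l).trans hlC.le
    have h1 := hl.abs_sub_le fun u => g.1 (G.vtx u)
    -- Cauchy–Schwarz: the increment on `e` is `√(len e)` times the gradient, so the two factors are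
    -- the total length, at most `C`, and the energy.
    have h2 := Finset.sum_mul_sq_le_sq_mul_sq l.toFinset (fun e => √(G.len e))
      (fun e => |G.gradL2 g e|)
    have h3 : ∑ e ∈ l.toFinset, |g.1 (G.vtx (G.endpt e true)) - g.1 (G.vtx (G.endpt e false))| =
        ∑ e ∈ l.toFinset, √(G.len e) * |G.gradL2 g e| := by
      refine Finset.sum_congr rfl fun e _ => ?_
      have hs : 0 < √(G.len e) := Real.sqrt_pos.2 (G.len_pos e)
      rw [gradL2_apply, grad, abs_div, abs_of_pos hs]
      field_simp
    have h4 : ∑ e ∈ l.toFinset, √(G.len e) ^ 2 ≤ C := by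
      rw [Finset.sum_congr rfl fun e _ => Real.sq_sqrt (G.len_pos e).le]
      exact (sum_toFinset_len_le l).trans hlC.le
    have h5 : ∑ e ∈ l.toFinset, |G.gradL2 g e| ^ 2 ≤ ‖G.gradL2 g‖ ^ 2 := by
      simpa only [sq_abs] using sum_sq_le_norm_sq (G.gradL2 g) l.toFinset
    refine (le_abs_self _).trans (h1.trans ?_)
    rw [h3]
    refine abs_le_of_sq_le_sq' ?_ (by positivity) |>.2
    rw [mul_pow, Real.sq_sqrt hC0]
    exact h2.trans (mul_le_mul h4 h5 (Finset.sum_nonneg fun _ _ => sq_nonneg _) hC0)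
  have h1 : ∀ v, ∀ x, g.1 x ≤ g.1 (G.vtx v) + √C * ‖G.gradL2 g‖ := fun v =>
    g.2.1.le g.1.continuous fun w => by linarith [hvert v w]
  have h2 := g.2.1.neg.le g.1.continuous.neg (c := √C * ‖G.gradL2 g‖ - g.1 x) (fun v => by
    have := h1 v x
    simp only [Pi.neg_apply]
    linarith) y
  simp only [Pi.neg_apply] at h2
  linarith

/-- A vertex function that is constant along all but finitely many edges extends to a function of
finite energy. -/
theorem exists_finiteEnergy (h : V → ℝ)
    (hfin : {e | h (G.endpt e true) ≠ h (G.endpt e false)}.Finite) :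
    ∃ g : G.finiteEnergy, ∀ p : G.Point, g.1 p = G.interp h p := by
  obtain ⟨g, hg, hp⟩ := exists_isEdgeAffine h hfin
  refine ⟨⟨g, hg, memℓp_gen (summable_of_hasFiniteSupport (hfin.subset fun e he hne => he ?_))⟩, hp⟩
  simp [grad, vtx, hp, hne]

/-! ### Minimizing the energy -/

variable (G) in
/-- The functions of finite energy that vanish on the boundary. -/
noncomputable def zeroBoundary : Submodule ℝ G.finiteEnergy where
  carrier := {φ | ∀ x ∈ G.boundary, φ.1 x = 0}
  zero_mem' _ _ := rfl
  add_mem' {f g} hf hg x hx := by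
    simp only [Submodule.coe_add, ContinuousMap.add_apply, hf x hx, hg x hx, add_zero]
  smul_mem' c g hg x hx := by
    simp only [Submodule.coe_smul, ContinuousMap.smul_apply, hg x hx, smul_zero]

open Classical in
/-- The hat function at an interior vertex. -/
theorem exists_hat {v : V} (hv : v ∉ G.bdry) :
    ∃ η ∈ G.zeroBoundary, ∀ u, η.1 (G.vtx u) = if u = v then 1 else 0 := by
  set h : V → ℝ := fun u => if u = v then 1 else 0 with hh
  obtain ⟨η, hη⟩ := exists_finiteEnergy (G := G) h
    ((finite_edges_at (G := G) v).subset fun e he => by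
      by_contra hne
      have h0 : G.endpt e false ≠ v := fun h => hne ⟨_, h⟩
      have h1 : G.endpt e true ≠ v := fun h => hne ⟨_, h⟩
      simp [hh, h0, h1] at he)
  refine ⟨η, fun x hx => ?_, fun u => hη _⟩
  -- The star of `v` is compact. Boundary points in it are boundary vertices, hence different from
  -- `v`; off it the hat function vanishes by density.
  have hK : IsCompact ({.vertex v} ∪ ⋃ e ∈ {e | ∃ i, G.endpt e i = v}, G.closedEdge e) :=
    isCompact_singleton.union
      ((finite_edges_at (G := G) v).isCompact_biUnion fun e _ => isCompact_closedEdge e)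
  by_cases hxK : x ∈ (fun p : G.Point => (p : G.Completion)) ''
      ({.vertex v} ∪ ⋃ e ∈ {e | ∃ i, G.endpt e i = v}, G.closedEdge e)
  · obtain ⟨p, -, rfl⟩ := hxK
    obtain ⟨w, hw, rfl⟩ := mem_boundary_iff.1 hx p rfl
    have : w ≠ v := fun h => hv (h ▸ hw)
    simp [hη, hh, this]
  · refine eq_of_eq_off_compact η.1.continuous continuous_const hK (fun p hp => ?_) hxK
    rw [hη]
    cases p with
    | vertex u =>
      have : u ≠ v := fun h => hp (Or.inl (by rw [h]; rfl))
      simp [hh, this]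
    | inner e t h₀ h₁ =>
      have hne : ¬ ∃ i, G.endpt e i = v := fun h =>
        hp (Or.inr (mem_biUnion h (inner_mem_closedEdge e t h₀ h₁)))
      have h0 : G.endpt e false ≠ v := fun h => hne ⟨_, h⟩
      have h1 : G.endpt e true ≠ v := fun h => hne ⟨_, h⟩
      rw [← edgePoint_inner G e t h₀ h₁, interp_edgePoint h ⟨h₀.le, h₁.le⟩]
      simp [hh, h0, h1]

open Classical in
/-- The energy inner product with a hat function. -/
theorem inner_gradL2_hat {v : V} {η : G.finiteEnergy}
    (hη : ∀ u, η.1 (G.vtx u) = if u = v then 1 else 0) {g : G.Completion → ℝ}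
    {w : lp (fun _ : E => ℝ) 2} (hw : ∀ e, w e = G.grad g e) :
    inner ℝ (G.gradL2 η) w = -∑ d ∈ (G.finite_ends v).toFinset, G.slope g d := by
  -- Each edge term is split over the two ends of the edge, to match the sum over ends; for a loop
  -- both sides are zero.
  have hterm : ∀ e, inner ℝ (G.gradL2 η e) (w e) =
      ∑ i : Bool, if G.endpt e i = v then -G.slope g (e, i) else 0 := by
    intro e
    have hl := G.len_pos e
    have hs : √(G.len e) * √(G.len e) = G.len e := Real.mul_self_sqrt hl.le
    rw [gradL2_apply, hw, Fintype.sum_bool]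
    have : inner ℝ (G.grad η.1 e) (G.grad g e) =
        (η.1 (G.vtx (G.endpt e true)) - η.1 (G.vtx (G.endpt e false))) *
        ((g (G.vtx (G.endpt e true)) - g (G.vtx (G.endpt e false))) / G.len e) := by
      simp only [grad, RCLike.inner_apply, conj_trivial]
      rw [div_mul_div_comm, hs]
      ring
    rw [this, hη, hη]
    simp only [slope, Bool.not_true, Bool.not_false]
    split_ifs <;> ring
  rw [lp.inner_eq_tsum, tsum_congr hterm,
    tsum_eq_sum (s := (finite_edges_at (G := G) v).toFinset) (fun e he => ?_),
    ← Finset.sum_product', ← Finset.sum_filter, ← Finset.sum_neg_distrib]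
  · refine Finset.sum_congr ?_ fun _ _ => rfl
    ext ⟨e, i⟩
    simp only [Finset.mem_filter, Finset.mem_product, Finite.mem_toFinset, mem_ofPred_eq,
      Finset.mem_univ, and_true]
    exact ⟨fun h => h.2, fun h => ⟨⟨i, h⟩, h⟩⟩
  · rw [Finite.mem_toFinset] at he
    exact Finset.sum_eq_zero fun i _ => if_neg fun h => he ⟨i, h⟩

theorem isClosed_isEdgeAffine : IsClosed {g : C(G.Completion, ℝ) | G.IsEdgeAffine g} := by
  simp only [IsEdgeAffine, ofPred_forall]
  refine isClosed_iInter fun e => isClosed_iInter fun t => isClosed_iInter fun _ => ?_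
  exact isClosed_eq (by fun_prop) (by fun_prop)

/-- The Dirichlet problem for boundary values of functions of finite energy. -/
theorem exists_isHarmonic_of_finiteEnergy [CompactSpace G.Completion] (hne : G.boundary.Nonempty)
    (f : G.finiteEnergy) :
    ∃ g : C(G.Completion, ℝ), G.IsHarmonic g ∧ ∀ x ∈ G.boundary, g x = f.1 x := by
  obtain ⟨b, hb⟩ := hne
  obtain ⟨C, hC⟩ : ∃ C, ∀ v w, dist (Point.vertex v : G.Point) (Point.vertex w) < C :=
    ⟨Metric.diam (univ : Set G.Completion) + 1, fun v w => by
      rw [← UniformSpace.Completion.dist_eq]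
      exact (Metric.dist_le_diam_of_mem isCompact_univ.isBounded (mem_univ _)
        (mem_univ _)).trans_lt (lt_add_one _)⟩
  -- A Poincaré inequality: the oscillation bound is applied against the boundary point `b`, where
  -- `φ` vanishes.
  have hbound : ∀ φ ∈ G.zeroBoundary, ‖φ.1‖ ≤ √C * ‖G.gradL2 φ‖ := by
    intro φ hφ
    refine (ContinuousMap.norm_le _ (by positivity)).2 fun x => ?_
    have h1 := sub_le_mul_norm_gradL2 hC φ x b
    have h2 := sub_le_mul_norm_gradL2 hC φ b x
    rw [hφ b hb] at h1 h2
    exact abs_le.2 ⟨by linarith, by linarith⟩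
  -- `P` is a limit of gradients of functions `φ n` vanishing on the boundary. By `hbound` the `φ n`
  -- converge uniformly, and comparing coordinates shows that `P` is the gradient of their limit
  -- `ψ`.
  obtain ⟨P, hP, w, hw, hPw⟩ :=
    (G.zeroBoundary.map G.gradL2).topologicalClosure.exists_add_mem_mem_orthogonal (G.gradL2 f)
  obtain ⟨y, hy, hyP⟩ := mem_closure_iff_seq_limit.1 hP
  choose φ hφ hφy using fun n => hy n
  have hcauchy : CauchySeq fun n => (φ n).1 := by
    refine Metric.cauchySeq_iff'.2 fun ε hε => ?_
    obtain ⟨N, hN⟩ := Metric.cauchySeq_iff'.1 hyP.cauchySeq (ε / (√C + 1)) (by positivity)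
    refine ⟨N, fun n hn => ?_⟩
    have h1 := hbound _ (G.zeroBoundary.sub_mem (hφ n) (hφ N))
    rw [map_sub, hφy, hφy, ← dist_eq_norm, Submodule.coe_sub, ← dist_eq_norm] at h1
    have h2 := hN n hn
    rw [lt_div_iff₀ (by positivity)] at h2
    nlinarith [dist_nonneg (x := y n) (y := y N), Real.sqrt_nonneg C]
  obtain ⟨ψ, hψ⟩ := cauchySeq_tendsto_of_complete hcauchy
  have hpt : ∀ x, Tendsto (fun n => (φ n).1 x) atTop (𝓝 (ψ x)) := fun x =>
    ((continuous_eval_const x).tendsto ψ).comp hψ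
  have hψa : G.IsEdgeAffine ψ :=
    isClosed_isEdgeAffine.mem_of_tendsto hψ (Eventually.of_forall fun n => (φ n).2.1)
  have hψP : ∀ e, P e = G.grad ψ e := by
    intro e
    have h1 : Tendsto (fun n => y n e) atTop (𝓝 (P e)) :=
      ((lp.evalCLM ℝ (fun _ : E => ℝ) 2 e).continuous.tendsto P).comp hyP
    refine tendsto_nhds_unique h1 ?_
    have h2 : (fun n => y n e) = fun n => G.grad (φ n).1 e := by
      ext n
      rw [← hφy, gradL2_apply]
    rw [h2]
    exact ((hpt _).sub (hpt _)).div_const _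
  have hga : G.IsEdgeAffine (f.1 - ψ : C(G.Completion, ℝ)) := by
    rw [sub_eq_add_neg]
    exact f.2.1.add hψa.neg
  refine ⟨f.1 - ψ, (isHarmonic_iff (map_continuous _)).2 ⟨hga, fun v hv => ?_⟩, fun x hx => ?_⟩
  -- The remainder `w` is the gradient of `f - ψ`, and its orthogonality to a hat function is the
  -- Kirchhoff condition.
  · obtain ⟨η, hη, hηv⟩ := exists_hat hv
    have h1 := (Submodule.mem_orthogonal _ _).1 hw _
      (Submodule.le_topologicalClosure _ (Submodule.mem_map_of_mem hη))
    rw [inner_gradL2_hat hηv (g := (f.1 - ψ : C(G.Completion, ℝ))) (fun e => ?_)] at h1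
    · linarith
    · have h2 : w = G.gradL2 f - P := by rw [hPw]; abel
      rw [h2, lp.coeFn_sub, Pi.sub_apply, gradL2_apply, hψP]
      simp only [grad, ContinuousMap.sub_apply]
      ring
  · have : ψ x = 0 := tendsto_nhds_unique (hpt x) (by
      simp only [fun n => hφ n x hx]
      exact tendsto_const_nhds)
    simp [this]

/-! ### The Dirichlet problem -/

/-- The Dirichlet problem for the indicator function of a clopen subset of the boundary. -/
theorem exists_isHarmonic_indicator [CompactSpace G.Completion] (hne : G.boundary.Nonempty)
    {C : Set G.boundary} (hC : IsClopen C) :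
    ∃ g : C(G.Completion, ℝ), G.IsHarmonic g ∧ ∀ x : G.boundary, g x = C.indicator 1 x := by
  have hcl := (isClosed_boundary (G := G)).isClosedEmbedding_subtypeVal.isClosedMap
  obtain ⟨k, hk0, hk1, -⟩ := exists_continuous_zero_one_of_isClosed
    (hcl _ hC.compl.isClosed) (hcl _ hC.isClosed)
    (disjoint_compl_left.image Subtype.val_injective.injOn (subset_univ _) (subset_univ _))
  -- A steepened Urysohn function: `0` where `k ≤ 1/3` and `1` where `k ≥ 2/3`. It varies only on a
  -- compact set disjoint from the boundary.
  set k' : C(G.Completion, ℝ) := ⟨fun x => max 0 (min 1 (3 * k x - 1)), by fun_prop⟩ with hk'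
  have hb : ∀ x : G.boundary, (k x = 0 ∧ x ∉ C) ∨ (k x = 1 ∧ x ∈ C) := fun x => by
    by_cases hx : x ∈ C
    · exact Or.inr ⟨hk1 ⟨x, hx, rfl⟩, hx⟩
    · exact Or.inl ⟨hk0 ⟨x, hx, rfl⟩, hx⟩
  have hK0 : IsCompact (k ⁻¹' Icc (1 / 3) (2 / 3)) := (isClosed_Icc.preimage k.continuous).isCompact
  have hB := finite_edges_of_isCompact hK0 (disjoint_left.2 fun x hx hxb => by
    rcases hb ⟨x, hxb⟩ with ⟨h, -⟩ | ⟨h, -⟩ <;>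
    · rw [mem_preimage, h] at hx
      norm_num at hx)
  set B := {e | ∃ p ∈ G.closedEdge e, (p : G.Completion) ∈ k ⁻¹' Icc (1 / 3) (2 / 3)}
  -- The values of `k` on a connected edge that avoid `[1/3, 2/3]` all lie on the same side of it.
  have hconst : ∀ e ∉ B, ∀ p ∈ G.closedEdge e, ∀ q ∈ G.closedEdge e, k' p = k' q := by
    intro e he p hp q hq
    have hpre : IsPreconnected ((fun p : G.Point => k p) '' G.closedEdge e) :=
      (isPreconnected_closedEdge e).image _
        (k.continuous.comp (UniformSpace.Completion.continuous_coe _)).continuousOn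
    have hord := hpre.ordConnected
    have hout : ∀ s ∈ (fun p : G.Point => k p) '' G.closedEdge e, s < 1 / 3 ∨ 2 / 3 < s := by
      rintro _ ⟨r, hr, rfl⟩
      by_contra! hcon
      exact he ⟨r, hr, hcon⟩
    have hmp := mem_image_of_mem (fun p : G.Point => k p) hp
    have hmq := mem_image_of_mem (fun p : G.Point => k p) hq
    have hlow : ∀ p : G.Point, k p < 1 / 3 → k' p = 0 := fun p h =>
      max_eq_left ((min_le_right _ _).trans (by linarith))
    have hhigh : ∀ p : G.Point, 2 / 3 < k p → k' p = 1 := fun p h => by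
      simp only [hk', ContinuousMap.coe_mk]
      rw [min_eq_left (by linarith)]
      norm_num
    rcases hout _ hmp with h1 | h1 <;> rcases hout _ hmq with h2 | h2
    · rw [hlow p h1, hlow q h2]
    · have := hout (1 / 3) (hord.out hmp hmq ⟨h1.le, by linarith⟩)
      norm_num at this
    · have := hout (1 / 3) (hord.out hmq hmp ⟨h2.le, by linarith⟩)
      norm_num at this
    · rw [hhigh p h1, hhigh q h2]
  obtain ⟨f, hf⟩ := exists_finiteEnergy (G := G) (fun v => k' (G.vtx v)) (hB.subset fun e he => by
    by_contra heB
    exact he (hconst e heB _ (endpt_mem_closedEdge e true) _ (endpt_mem_closedEdge e false)))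
  -- Interpolation may change `k'` only inside the finitely many edges of `B`, whose only boundary
  -- points are vertices; elsewhere the two functions agree on the graph, hence by density on the
  -- completion.
  have hfb : ∀ x ∈ G.boundary, f.1 x = k' x := by
    intro x hx
    have hK : IsCompact (⋃ e ∈ B, G.closedEdge e) :=
      hB.isCompact_biUnion fun e _ => isCompact_closedEdge e
    by_cases hxK : x ∈ (fun p : G.Point => (p : G.Completion)) '' ⋃ e ∈ B, G.closedEdge e
    · obtain ⟨p, -, rfl⟩ := hxK
      obtain ⟨w, hw, rfl⟩ := mem_boundary_iff.1 hx p rfl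
      exact hf _
    · refine eq_of_eq_off_compact f.1.continuous k'.continuous hK (fun p hp => ?_) hxK
      rw [hf]
      cases p with
      | vertex u => rfl
      | inner e t h₀ h₁ =>
        have hin := inner_mem_closedEdge e t h₀ h₁
        have heB : e ∉ B := fun he => hp (mem_biUnion he hin)
        have h0 : k' (G.vtx (G.endpt e false)) = _ :=
          hconst e heB _ (endpt_mem_closedEdge e false) _ hin
        have h1 : k' (G.vtx (G.endpt e true)) = _ :=
          hconst e heB _ (endpt_mem_closedEdge e true) _ hin
        conv_lhs => rw [← edgePoint_inner G e t h₀ h₁]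
        rw [interp_edgePoint _ ⟨h₀.le, h₁.le⟩, h0, h1]
        ring
  obtain ⟨g, hg, hgf⟩ := exists_isHarmonic_of_finiteEnergy hne f
  refine ⟨g, hg, fun x => ?_⟩
  rw [hgf x x.2, hfb x x.2]
  rcases hb x with ⟨h, hx⟩ | ⟨h, hx⟩
  · rw [indicator_of_notMem hx]
    simp [hk', h]
  · rw [indicator_of_mem hx]
    simp only [hk', ContinuousMap.coe_mk, h, Pi.one_apply]
    norm_num

theorem slope_add (f g : G.Completion → ℝ) : G.slope (f + g) = G.slope f + G.slope g := by
  ext d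
  simp only [slope, Pi.add_apply]
  ring

theorem slope_smul (c : ℝ) (g : G.Completion → ℝ) : G.slope (c • g) = c • G.slope g := by
  ext d
  simp only [slope, Pi.smul_apply, smul_eq_mul]
  ring

theorem IsHarmonic.add {f g : G.Completion → ℝ} (hf : G.IsHarmonic f) (hg : G.IsHarmonic g) :
    G.IsHarmonic (f + g) := by
  obtain ⟨fa, fk⟩ := (isHarmonic_iff hf.continuous).1 hf
  obtain ⟨ga, gk⟩ := (isHarmonic_iff hg.continuous).1 hg
  refine (isHarmonic_iff (hf.continuous.add hg.continuous)).2 ⟨fa.add ga, fun v hv => ?_⟩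
  simp only [slope_add, Pi.add_apply, Finset.sum_add_distrib, fk v hv, gk v hv, add_zero]

theorem IsHarmonic.smul (c : ℝ) {g : G.Completion → ℝ} (hg : G.IsHarmonic g) :
    G.IsHarmonic (c • g) := by
  obtain ⟨ga, gk⟩ := (isHarmonic_iff hg.continuous).1 hg
  refine (isHarmonic_iff (hg.continuous.const_smul c)).2 ⟨ga.smul c, fun v hv => ?_⟩
  simp only [slope_smul, Pi.smul_apply, ← Finset.smul_sum, gk v hv, smul_zero]

variable (G) in
/-- The space of harmonic functions. -/
noncomputable def harmonic : Submodule ℝ C(G.Completion, ℝ) where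
  carrier := {g | G.IsHarmonic g}
  zero_mem' := (isHarmonic_iff (map_continuous (0 : C(G.Completion, ℝ)))).2
    ⟨fun e t _ => by simp, fun v _ => by simp [slope]⟩
  add_mem' hf hg := hf.add hg
  smul_mem' c _ hg := hg.smul c

theorem isClosed_harmonic : IsClosed (G.harmonic : Set C(G.Completion, ℝ)) := by
  have : (G.harmonic : Set C(G.Completion, ℝ)) = {g : C(G.Completion, ℝ) | G.IsEdgeAffine g} ∩
      ⋂ v, ⋂ (_ : v ∉ G.bdry), {g | ∑ d ∈ (G.finite_ends v).toFinset, G.slope g d = 0} := by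
    ext g
    simp only [mem_inter_iff, mem_iInter]
    exact isHarmonic_iff g.continuous
  rw [this]
  refine isClosed_isEdgeAffine.inter (isClosed_iInter fun v => isClosed_iInter fun _ => ?_)
  exact isClosed_eq (by simp only [slope]; fun_prop) continuous_const

theorem IsHarmonic.abs_le_of_boundary [CompactSpace G.Completion] (hne : G.boundary.Nonempty)
    {g : G.Completion → ℝ} (hg : G.IsHarmonic g) {c : ℝ} (h : ∀ x ∈ G.boundary, |g x| ≤ c)
    (x : G.Completion) : |g x| ≤ c := by
  have h1 := hg.le_of_boundary hne (fun y hy => (abs_le.1 (h y hy)).2) x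
  have h2 := (hg.smul (-1)).le_of_boundary hne (c := c) (fun y hy => by
    have := (abs_le.1 (h y hy)).1
    simp only [Pi.smul_apply, smul_eq_mul]
    linarith) x
  simp only [Pi.smul_apply, smul_eq_mul] at h2
  exact abs_le.2 ⟨by linarith, h1⟩

instance [CompactSpace G.Completion] : CompactSpace G.boundary :=
  isCompact_iff_compactSpace.1 isClosed_boundary.isCompact

/-- The restriction of harmonic functions to the boundary, which preserves the supremum norm. -/
noncomputable def restrictBoundary [CompactSpace G.Completion] (hne : G.boundary.Nonempty) :
    G.harmonic →ₗᵢ[ℝ] C(G.boundary, ℝ) where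
  toFun g := g.1.restrict G.boundary
  map_add' _ _ := rfl
  map_smul' _ _ := rfl
  norm_map' g := by
    refine le_antisymm ?_ ?_
    · exact (ContinuousMap.norm_le _ (norm_nonneg _)).2 fun x => g.1.norm_coe_le_norm x
    · refine (ContinuousMap.norm_le _ (norm_nonneg _)).2 fun x =>
        g.2.abs_le_of_boundary hne (fun y hy => ?_) x
      exact (g.1.restrict G.boundary).norm_coe_le_norm ⟨y, hy⟩

/-- By compactness, a locally constant function is a finite linear combination of indicators of its
clopen fibres. -/
theorem locallyConstant_mem_range [CompactSpace G.Completion] (hne : G.boundary.Nonempty)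
    (c : LocallyConstant G.boundary ℝ) :
    (c : C(G.boundary, ℝ)) ∈ LinearMap.range (restrictBoundary hne).toLinearMap := by
  have hc : (c : C(G.boundary, ℝ)) = ∑ y ∈ c.range_finite.toFinset,
      y • (LocallyConstant.charFn ℝ (c.isLocallyConstant.isClopen_fiber y) :
        C(G.boundary, ℝ)) := by
    ext x
    simp only [ContinuousMap.sum_apply, ContinuousMap.smul_apply, LocallyConstant.coe_continuousMap,
      LocallyConstant.coe_charFn, smul_eq_mul]
    rw [Finset.sum_eq_single (c x)]
    · simp
    · intro y _ hy
      simp [indicator, hy.symm]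
    · simp
  rw [hc]
  refine Submodule.sum_mem _ fun y _ => Submodule.smul_mem _ _ ?_
  have hy := c.isLocallyConstant.isClopen_fiber y
  obtain ⟨g, hg, hgx⟩ := exists_isHarmonic_indicator hne hy
  refine ⟨⟨g, hg⟩, ContinuousMap.ext fun x => ?_⟩
  exact (hgx x).trans (congrFun (LocallyConstant.coe_charFn ℝ hy).symm x)

/-- The range is closed, being an isometric image of a complete space, and it contains the locally
constant functions. These form a subalgebra separating the points of a compact totally disconnected
space, so Stone–Weierstrass makes them dense. -/
theorem restrictBoundary_surjective [CompactSpace G.Completion] (hne : G.boundary.Nonempty)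
    (hd : IsTotallyDisconnected G.boundary) : Function.Surjective (restrictBoundary hne) := by
  have : TotallyDisconnectedSpace G.boundary := totallyDisconnectedSpace_subtype_iff.2 hd
  have : CompleteSpace G.harmonic := isClosed_harmonic.completeSpace_coe
  intro F
  have hcl : IsClosed (range (restrictBoundary hne)) :=
    (restrictBoundary hne).isometry.isClosedEmbedding.isClosed_range
  have hF := ContinuousMap.continuousMap_mem_subalgebra_closure_of_separatesPoints _
    (LocallyConstant.separatesPoints_range_toContinuousMapAlgHom (X := G.boundary) (Y := ℝ) ℝ) F
  refine closure_minimal ?_ hcl hF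
  rintro _ ⟨c, rfl⟩
  exact locallyConstant_mem_range hne c

end MetricGraph

theorem corollary3p6 {V E : Type*} [Countable V] [Countable E] (G : MetricGraph V E)
    (hcompact : CompactSpace G.Completion)
    (hdisconnected : IsTotallyDisconnected G.boundary)
    (hnonempty : G.boundary.Nonempty)
    (F : G.boundary → ℝ) (hF : Continuous F) :
    ∃! g : G.Completion → ℝ, G.IsHarmonic g ∧ ∀ x : G.boundary, g x = F x := by
  obtain ⟨g, hg⟩ := MetricGraph.restrictBoundary_surjective hnonempty hdisconnected ⟨F, hF⟩
  have hgF : ∀ x : G.boundary, g.1 x = F x := fun x => DFunLike.congr_fun hg x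
  refine ⟨g.1, ⟨g.2, hgF⟩, fun f ⟨hf, hfF⟩ => funext fun x => ?_⟩
  -- The difference of two solutions is harmonic and zero on the boundary.
  have h := (hf.add (g.2.smul (-1))).abs_le_of_boundary hnonempty (c := 0) (fun y hy => by
    simp [hfF ⟨y, hy⟩, hgF ⟨y, hy⟩]) x
  simp only [Pi.add_apply, Pi.smul_apply, smul_eq_mul] at h
  linarith [abs_nonpos_iff.1 h]
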